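/- Let $k$ be a commutative ring, $A$ an associative unital $k$-algebra, and $\mathfrak C$ an $A$-coring, i.e. an $A$-bimodule (on which the two $k$-actions agree) with $A$-bimodule maps $\Delta:\mathfrak C\to\mathfrak C\otimes_A\mathfrak C$ and $\varepsilon:\mathfrak C\to A$ that are coassociative and counital. Let $M$ be a right $\mathfrak C$-comodule, with coaction $m\mapsto\sum m_{(0)}\otimes m_{(1)}\in M\otimes_A\mathfrak C$, that is finitely generated and projective as a right $A$-module. Let $B=\mathrm{End}^{\mathfrak C}(M)$ be the $k$-algebra of right $\mathfrak C$-colinear endomorphisms of $M$ (with product given by composition), and let $M^*=\mathrm{Hom}_A(M,A)$, regarded as a left $\mathfrak C$-comodule with coaction $\xi\mapsto\sum_i\xi(e^i_{(0)})e^i_{(1)}\otimes\xi^i$, where $\{e^i\in M,\ \xi^i\in M^*\}$ is a dual basis of $M$. Write $\otimes$ for $\otimes_k$, regard $M^*\otimes M$ as a left $\mathfrak C$-comodule through the coaction of $M^*$, and regard the group ${}^{\mathfrak C}\mathrm{Hom}(M^*,M^*\otimes M)$ of left $\mathfrak C$-colinear maps as a left $B$-module by $(bf)(\xi)=f(\xi\circ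 b)$. Suppose that: (a) $\mathfrak C$ is flat as a left $A$-module; (b) the map $$B\otimes M\to{}^{\mathfrak C}\mathrm{Hom}(M^*,M^*\otimes M),\qquad b\otimes m\mapsto[\xi\mapsto(\xi\circ b)\otimes m]$$ is an isomorphism of left $B$-modules; (c) the map $$\widetilde{\mathrm{can}}_M:M^*\otimes M\to\mathfrak C,\qquad \xi\otimes m\mapsto\sum\xi(m_{(0)})m_{(1)}$$ is a split epimorphism of left $\mathfrak C$-comodules, i.e. it has a left $\mathfrak C$-colinear section. Then $M$ is a Galois comodule, i.e. ($M$ is finitely generated projective as a right $A$-module and) the evaluation map $$\varphi_{\mathfrak C}:\mathrm{Hom}^{\mathfrak C}(M,\mathfrak C)\otimes_BM\to\mathfrak C,\qquad f\otimes m\mapsto f(m)$$ is an isomorphism of right $\mathfrak C$-comodules, where $\mathrm{Hom}^{\mathfrak C}(M,\mathfrak C)$ is a right $B$-module by $fb=f\circ b$ and the coaction of the left-hand side is $f\otimes m\mapsto\sum f\otimes m_{(0)}\otimes m_{(1)}$. Moreover, $M$ is a $k$-relatively projective left $B$-module, i.e. every epimorphism of left $B$-modules $N\to M$ that splits as a $k$-module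 map splits as a $B$-module map. -/

import Mathlib

set_option linter.unusedSectionVars false

open scoped TensorProduct
open MulOpposite (op unop)

universe u v w

namespace GaloisCoring

/-! ### Tensor products over a noncommutative ring

Right `A`-modules are modules over `Aᵐᵒᵖ`, with `m · a = op a • m`. -/

section BTensor

/-- The subgroup of `X ⊗[ℤ] N` generated by the elements `x · a ⊗ n - x ⊗ a · n`. -/
def balancedRel (A X N : Type*) [Ring A] [AddCommGroup X] [Module Aᵐᵒᵖ X]
    [AddCommGroup N] [Module A N] : AddSubgroup (X ⊗[ℤ] N) :=
  AddSubgroup.closure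
    {t | ∃ (x : X) (a : A) (n : N), t = (op a • x) ⊗ₜ[ℤ] n - x ⊗ₜ[ℤ] (a • n)}

/-- The tensor product `X ⊗_A N` of a right `A`-module `X` and a left `A`-module `N` over a
not necessarily commutative ring `A`. -/
def BTensor (A : Type u) (X : Type v) (N : Type w) [Ring A] [AddCommGroup X] [Module Aᵐᵒᵖ X]
    [AddCommGroup N] [Module A N] : Type (max v w) :=
  (X ⊗[ℤ] N) ⧸ balancedRel A X N

namespace BTensor

variable {A X Y N P Z : Type*} [Ring A]
  [AddCommGroup X] [Module Aᵐᵒᵖ X] [AddCommGroup Y] [Module Aᵐᵒᵖ Y]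
  [AddCommGroup N] [Module A N] [AddCommGroup P] [Module A P] [AddCommGroup Z]

instance : AddCommGroup (BTensor A X N) :=
  inferInstanceAs (AddCommGroup ((X ⊗[ℤ] N) ⧸ balancedRel A X N))

variable (A X N) in
/-- The universal biadditive map `(x, n) ↦ x ⊗ n`. -/
def mk : X →+ N →+ BTensor A X N :=
  AddMonoidHom.mk' (fun x => (QuotientAddGroup.mk' (balancedRel A X N)).comp
      (TensorProduct.mk ℤ X N x).toAddMonoidHom) (by
    intro x y
    ext n
    exact congrArg (QuotientAddGroup.mk' (balancedRel A X N)) (TensorProduct.add_tmul x y n))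

variable (A) in
/-- The pure tensor `x ⊗ n` in `X ⊗_A N`. -/
def tmul (x : X) (n : N) : BTensor A X N := mk A X N x n

theorem add_tmul (x y : X) (n : N) : tmul A (x + y) n = tmul A x n + tmul A y n := by
  simp [tmul]

theorem tmul_add (x : X) (n p : N) : tmul A x (n + p) = tmul A x n + tmul A x p := by
  simp [tmul]

@[simp]
theorem zero_tmul (n : N) : tmul A (0 : X) n = 0 := by simp [tmul]

@[simp]
theorem tmul_zero (x : X) : tmul A x (0 : N) = 0 := by simp [tmul]

theorem neg_tmul (x : X) (n : N) : tmul A (-x) n = -tmul A x n := by simp [tmul]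

theorem tmul_neg (x : X) (n : N) : tmul A x (-n) = -tmul A x n := by simp [tmul]

theorem sum_tmul {ι : Type*} (s : Finset ι) (x : ι → X) (n : N) :
    tmul A (∑ i ∈ s, x i) n = ∑ i ∈ s, tmul A (x i) n := by
  simp [tmul]

theorem tmul_sum {ι : Type*} (s : Finset ι) (x : X) (n : ι → N) :
    tmul A x (∑ i ∈ s, n i) = ∑ i ∈ s, tmul A x (n i) := by
  simp [tmul]

theorem smul_tmul (x : X) (a : A) (n : N) : tmul A (op a • x) n = tmul A x (a • n) :=
  (QuotientAddGroup.eq_iff_sub_mem (N := balancedRel A X N)).mpr (AddSubgroup.subset_closure ⟨x, a, n, rfl⟩)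

@[elab_as_elim]
theorem induction_on {p : BTensor A X N → Prop} (t : BTensor A X N) (zero : p 0)
    (tmul : ∀ x n, p (tmul A x n)) (add : ∀ s t, p s → p t → p (s + t)) : p t := by
  obtain ⟨t, rfl⟩ := QuotientAddGroup.mk'_surjective (balancedRel A X N) t
  induction t using TensorProduct.induction_on with
  | zero => exact zero
  | tmul x n => exact tmul x n
  | add s t hs ht => exact add _ _ hs ht

theorem hom_ext {f g : BTensor A X N →+ Z} (h : ∀ x n, f (tmul A x n) = g (tmul A x n)) :
    f = g := by
  ext t
  induction t using induction_on with
  | zero => simp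
  | tmul x n => exact h x n
  | add s t hs ht => simp [hs, ht]

/-- The additive map out of `X ⊗_A N` induced by an `A`-balanced biadditive map. -/
def lift (f : X →+ N →+ Z) (h : ∀ x (a : A) n, f (op a • x) n = f x (a • n)) :
    BTensor A X N →+ Z :=
  QuotientAddGroup.lift (balancedRel A X N)
    (TensorProduct.liftAddHom f (by intro r x n; simp)) (by
      rw [balancedRel, AddSubgroup.closure_le]
      rintro _ ⟨x, a, n, rfl⟩
      simp [AddMonoidHom.mem_ker, h])

@[simp]
theorem lift_tmul (f : X →+ N →+ Z) (h : ∀ x (a : A) n, f (op a • x) n = f x (a • n))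
    (x : X) (n : N) : lift f h (tmul A x n) = f x n :=
  rfl

/-- The map `f ⊗_A g` for a right `A`-linear `f` and a left `A`-linear `g`. -/
def map (f : X →ₗ[Aᵐᵒᵖ] Y) (g : N →ₗ[A] P) : BTensor A X N →+ BTensor A Y P :=
  lift (((mk A Y P).comp f.toAddMonoidHom).compl₂ g.toAddMonoidHom) (by
    intro x a n
    change tmul A (f (op a • x)) (g n) = tmul A (f x) (g (a • n))
    rw [map_smul, map_smul, smul_tmul])

@[simp]
theorem map_tmul (f : X →ₗ[Aᵐᵒᵖ] Y) (g : N →ₗ[A] P) (x : X) (n : N) :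
    map f g (tmul A x n) = tmul A (f x) (g n) :=
  lift_tmul _ _ x n

section left

variable {R : Type*} [Semiring R] [Module R X] [SMulCommClass R Aᵐᵒᵖ X]

variable (A X N R) in
/-- The left action of `R` on `X ⊗_A N`, as a ring homomorphism. -/
def leftAction : R →+* AddMonoid.End (BTensor A X N) where
  toFun r := map (Module.toModuleEnd Aᵐᵒᵖ (S := R) X r) LinearMap.id
  map_one' := hom_ext fun x n => by simp; rfl
  map_mul' r s := hom_ext fun x n => by
    change _ = map _ _ (map _ _ (tmul A x n))
    simp [mul_smul]
  map_zero' := hom_ext fun x n => by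
    rw [map_tmul]
    simp [tmul]
    rfl
  map_add' r s := hom_ext fun x n => by
    change _ = map _ _ (tmul A x n) + map _ _ (tmul A x n)
    simp [add_smul, add_tmul]

/-- The left action `r · (x ⊗ n) = (r · x) ⊗ n`. -/
instance leftModule : Module R (BTensor A X N) := Module.compHom _ (leftAction A X N R)

@[simp]
theorem smul_tmul_left (r : R) (x : X) (n : N) : r • tmul A x n = tmul A (r • x) n :=
  map_tmul _ _ x n

end left

section right

variable {S : Type*} [Semiring S] [Module Sᵐᵒᵖ N] [SMulCommClass A Sᵐᵒᵖ N]

variable (A X N S) in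
/-- The right action of `S` on `X ⊗_A N`, as a ring homomorphism. -/
def rightAction : Sᵐᵒᵖ →+* AddMonoid.End (BTensor A X N) where
  toFun s := map LinearMap.id (@Module.toModuleEnd A Sᵐᵒᵖ N _ _ _ _ _ (SMulCommClass.symm _ _ _) s)
  map_one' := hom_ext fun x n => by simp; rfl
  map_mul' r s := hom_ext fun x n => by
    change _ = map _ _ (map _ _ (tmul A x n))
    simp [mul_smul]
  map_zero' := hom_ext fun x n => by
    rw [map_tmul]
    simp [tmul]
    rfl
  map_add' r s := hom_ext fun x n => by
    change _ = map _ _ (tmul A x n) + map _ _ (tmul A x n)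
    simp [add_smul, tmul_add]

/-- The right action `(x ⊗ n) · s = x ⊗ (n · s)`. -/
instance rightModule : Module Sᵐᵒᵖ (BTensor A X N) := Module.compHom _ (rightAction A X N S)

@[simp]
theorem smul_tmul_right (s : Sᵐᵒᵖ) (x : X) (n : N) : s • tmul A x n = tmul A x (s • n) :=
  map_tmul _ _ x n

end right

instance {R S : Type*} [Semiring R] [Module R X] [SMulCommClass R Aᵐᵒᵖ X]
    [Semiring S] [Module Sᵐᵒᵖ N] [SMulCommClass A Sᵐᵒᵖ N] :
    SMulCommClass R Sᵐᵒᵖ (BTensor A X N) where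
  smul_comm r s t := by
    induction t using induction_on with
    | zero => simp
    | tmul x n => simp
    | add p q hp hq => simp [smul_add, hp, hq]

section linear

variable {R : Type*} [Semiring R] [Module R X] [SMulCommClass R Aᵐᵒᵖ X]
  {S : Type*} [Semiring S] [Module Sᵐᵒᵖ N] [SMulCommClass A Sᵐᵒᵖ N]

/-- `n ↦ x ⊗ n`, as a right linear map. -/
def tmulRight (x : X) : N →ₗ[Sᵐᵒᵖ] BTensor A X N where
  toFun n := tmul A x n
  map_add' := tmul_add x
  map_smul' s n := (smul_tmul_right s x n).symm

/-- `x ↦ x ⊗ n`, as a left linear map. -/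
def tmulLeft (n : N) : X →ₗ[R] BTensor A X N where
  toFun x := tmul A x n
  map_add' x y := add_tmul x y n
  map_smul' r x := (smul_tmul_left r x n).symm

@[simp]
theorem tmulRight_apply (x : X) (n : N) : tmulRight (A := A) (S := S) x n = tmul A x n := rfl

@[simp]
theorem tmulLeft_apply (n : N) (x : X) : tmulLeft (A := A) (R := R) n x = tmul A x n := rfl

theorem tmulRight_add (x y : X) : tmulRight (A := A) (N := N) (S := S) (x + y) =
    tmulRight x + tmulRight y :=
  LinearMap.ext fun n => add_tmul x y n

end linear

/-- The canonical map `A ⊗_A N → N`, `a ⊗ n ↦ a · n`. -/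
def lid (A N : Type*) [Ring A] [AddCommGroup N] [Module A N] : BTensor A A N →+ N :=
  lift (AddMonoidHom.smul (R := A) (M := N)) (by intro x a n; simp [mul_smul])

@[simp]
theorem lid_tmul (a : A) (n : N) : lid A N (tmul A a n) = a • n := lift_tmul _ _ a n

/-- The canonical map `X ⊗_A A → X`, `x ⊗ a ↦ x · a`. -/
def rid (A X : Type*) [Ring A] [AddCommGroup X] [Module Aᵐᵒᵖ X] : BTensor A X A →+ X :=
  lift (((AddMonoidHom.smul (R := Aᵐᵒᵖ) (M := X)).comp
    (MulOpposite.opAddEquiv (α := A)).toAddMonoidHom).flip) (by intro x a n; simp [mul_smul])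

@[simp]
theorem rid_tmul (x : X) (a : A) : rid A X (tmul A x a) = op a • x := lift_tmul _ _ x a

/-- The canonical map `(X ⊗_A Y) ⊗_B Z → X ⊗_A (Y ⊗_B Z)`, `(x ⊗ y) ⊗ z ↦ x ⊗ (y ⊗ z)`. -/
def assoc (A B X Y Z : Type*) [Ring A] [Ring B] [AddCommGroup X] [Module Aᵐᵒᵖ X]
    [AddCommGroup Y] [Module A Y] [Module Bᵐᵒᵖ Y] [SMulCommClass A Bᵐᵒᵖ Y]
    [AddCommGroup Z] [Module B Z] :
    BTensor B (BTensor A X Y) Z →+ BTensor A X (BTensor B Y Z) :=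
  lift (AddMonoidHom.flip (AddMonoidHom.mk' (fun z => map LinearMap.id (tmulLeft (R := A) z)) (by
    intro z z'
    refine hom_ext fun x y => ?_
    simp [tmulLeft, tmul_add]))) (by
    intro t b z
    induction t using induction_on with
    | zero => simp
    | tmul x y => simp [tmulLeft, smul_tmul]
    | add s t hs ht => rw [smul_add, map_add, map_add, AddMonoidHom.add_apply, hs, ht]; rfl)

@[simp]
theorem assoc_tmul {B : Type*} [Ring B] {Y Z : Type*} [AddCommGroup Y] [Module A Y] [Module Bᵐᵒᵖ Y]
    [SMulCommClass A Bᵐᵒᵖ Y] [AddCommGroup Z] [Module B Z] (x : X) (y : Y) (z : Z) :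
    assoc A B X Y Z (tmul B (tmul A x y) z) = tmul A x (tmul B y z) := by
  rw [assoc, lift_tmul]
  simp [tmulLeft]

theorem map_comp {X' N' : Type*} [AddCommGroup X'] [Module Aᵐᵒᵖ X'] [AddCommGroup N']
    [Module A N'] (f' : Y →ₗ[Aᵐᵒᵖ] X') (f : X →ₗ[Aᵐᵒᵖ] Y) (g' : P →ₗ[A] N') (g : N →ₗ[A] P)
    (t : BTensor A X N) : map (f' ∘ₗ f) (g' ∘ₗ g) t = map f' g' (map f g t) := by
  induction t using induction_on with
  | zero => simp
  | tmul x n => simp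
  | add s t hs ht => simp [hs, ht]

@[simp]
theorem map_id (t : BTensor A X N) : map LinearMap.id LinearMap.id t = t := by
  induction t using induction_on with
  | zero => simp
  | tmul x n => simp
  | add s t hs ht => simp [hs, ht]

theorem map_add_left (f f' : X →ₗ[Aᵐᵒᵖ] Y) (g : N →ₗ[A] P) : map (f + f') g = map f g + map f' g :=
  hom_ext fun x n => by simp [add_tmul]

theorem map_add_right (f : X →ₗ[Aᵐᵒᵖ] Y) (g g' : N →ₗ[A] P) : map f (g + g') = map f g + map f g' :=
  hom_ext fun x n => by simp [tmul_add]

theorem map_zero_left (g : N →ₗ[A] P) : map (0 : X →ₗ[Aᵐᵒᵖ] Y) g = 0 :=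
  hom_ext fun x n => by simp

theorem map_zero_right (f : X →ₗ[Aᵐᵒᵖ] Y) : map f (0 : N →ₗ[A] P) = 0 :=
  hom_ext fun x n => by simp

theorem map_neg_left (f : X →ₗ[Aᵐᵒᵖ] Y) (g : N →ₗ[A] P) : map (-f) g = -map f g :=
  hom_ext fun x n => by simp [neg_tmul]

theorem map_neg_right (f : X →ₗ[Aᵐᵒᵖ] Y) (g : N →ₗ[A] P) : map f (-g) = -map f g :=
  hom_ext fun x n => by simp [tmul_neg]

theorem map_smul_right {S : Type*} [Semiring S] [Module Sᵐᵒᵖ N] [SMulCommClass A Sᵐᵒᵖ N]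
    [Module Sᵐᵒᵖ P] [SMulCommClass A Sᵐᵒᵖ P] (f : X →ₗ[Aᵐᵒᵖ] Y) (g : N →ₗ[A] P) (s : Sᵐᵒᵖ)
    (hg : ∀ n, g (s • n) = s • g n) (t : BTensor A X N) : map f g (s • t) = s • map f g t := by
  induction t using induction_on with
  | zero => simp
  | tmul x n => simp [hg]
  | add s t hs ht => simp [hs, ht, smul_add]

theorem map_smul_left {R : Type*} [Semiring R] [Module R X] [SMulCommClass R Aᵐᵒᵖ X]
    [Module R Y] [SMulCommClass R Aᵐᵒᵖ Y] (f : X →ₗ[Aᵐᵒᵖ] Y) (g : N →ₗ[A] P) (r : R)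
    (hf : ∀ x, f (r • x) = r • f x) (t : BTensor A X N) : map f g (r • t) = r • map f g t := by
  induction t using induction_on with
  | zero => simp
  | tmul x n => simp [hf]
  | add s t hs ht => simp [hs, ht, smul_add]

/-- `X ⊗_A f` as a left linear map, for a bimodule `X` and a left linear `f`. -/
def mapLeft {R : Type*} [Semiring R] [Module R X] [SMulCommClass R Aᵐᵒᵖ X]
    (f : N →ₗ[A] P) : BTensor A X N →ₗ[R] BTensor A X P where
  toFun := map LinearMap.id f
  map_add' := map_add _
  map_smul' r t := map_smul_left LinearMap.id f r (fun _ => rfl) t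

/-- `f ⊗_A N` as a right linear map, for a right linear `f` and a bimodule `N`. -/
def mapRight {S : Type*} [Semiring S] [Module Sᵐᵒᵖ N] [SMulCommClass A Sᵐᵒᵖ N]
    (f : X →ₗ[Aᵐᵒᵖ] Y) : BTensor A X N →ₗ[Sᵐᵒᵖ] BTensor A Y N where
  toFun := map f LinearMap.id
  map_add' := map_add _
  map_smul' s t := map_smul_right f LinearMap.id s (fun _ => rfl) t

/-- The right linear map out of `X ⊗_A N` induced by a balanced family of right linear maps. -/
def liftRight {S : Type*} [Semiring S] [Module Sᵐᵒᵖ N] [SMulCommClass A Sᵐᵒᵖ N] [Module Sᵐᵒᵖ Z]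
    (f : X →+ N →ₗ[Sᵐᵒᵖ] Z) (h : ∀ x (a : A) n, f (op a • x) n = f x (a • n)) :
    BTensor A X N →ₗ[Sᵐᵒᵖ] Z where
  toFun := lift (AddMonoidHom.mk' (fun x => (f x).toAddMonoidHom) fun x y => by
    rw [map_add]
    rfl) h
  map_add' := map_add _
  map_smul' s t := by
    induction t using induction_on with
    | zero => simp
    | tmul x n =>
      rw [smul_tmul_right]
      exact map_smul (f x) s n
    | add p q hp hq => rw [smul_add, map_add, map_add, hp, hq, smul_add]

theorem liftRight_tmul {S : Type*} [Semiring S] [Module Sᵐᵒᵖ N] [SMulCommClass A Sᵐᵒᵖ N]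
    [Module Sᵐᵒᵖ Z] (f : X →+ N →ₗ[Sᵐᵒᵖ] Z)
    (h : ∀ x (a : A) n, f (op a • x) n = f x (a • n)) (x : X) (n : N) :
    liftRight f h (tmul A x n) = f x n := rfl

end BTensor
end BTensor

open BTensor

/-! ### Corings and comodules -/

/-- `A`-bimodule maps. -/
structure BimodHom (A C D : Type*) [Ring A] [AddCommGroup C] [Module A C] [Module Aᵐᵒᵖ C]
    [AddCommGroup D] [Module A D] [Module Aᵐᵒᵖ D] extends C →ₗ[A] D where
  map_op_smul' : ∀ (a : Aᵐᵒᵖ) (c : C), toFun (a • c) = a • toFun c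

namespace BimodHom

variable {A C D : Type*} [Ring A] [AddCommGroup C] [Module A C] [Module Aᵐᵒᵖ C]
    [AddCommGroup D] [Module A D] [Module Aᵐᵒᵖ D]

/-- The underlying left linear map. -/
abbrev left (f : BimodHom A C D) : C →ₗ[A] D := f.toLinearMap

/-- The underlying right linear map. -/
def right (f : BimodHom A C D) : C →ₗ[Aᵐᵒᵖ] D where
  toFun := f.left
  map_add' := f.left.map_add
  map_smul' := f.map_op_smul'

@[simp] theorem right_apply (f : BimodHom A C D) (c : C) : f.right c = f.left c := rfl

end BimodHom

/-- `A`-corings: `A`-bimodules with a coassociative and counital bimodule coproduct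
`C → C ⊗_A C`. -/
class Coring (A C : Type*) [Ring A] [AddCommGroup C] [Module A C] [Module Aᵐᵒᵖ C]
    [SMulCommClass A Aᵐᵒᵖ C] where
  comul : BimodHom A C (BTensor A C C)
  counit : BimodHom A C A
  coassoc : ∀ c, assoc A A C C C (map comul.right LinearMap.id (comul.left c)) =
    map LinearMap.id comul.left (comul.left c)
  counit_left : ∀ c, lid A C (map counit.right LinearMap.id (comul.left c)) = c
  counit_right : ∀ c, rid A C (map LinearMap.id counit.left (comul.left c)) = c

/-- Right comodules over an `A`-coring `C`. -/
class RightComodule (A C M : Type*) [Ring A] [AddCommGroup C] [Module A C] [Module Aᵐᵒᵖ C]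
    [SMulCommClass A Aᵐᵒᵖ C] [Coring A C] [AddCommGroup M] [Module Aᵐᵒᵖ M] where
  coact : M →ₗ[Aᵐᵒᵖ] BTensor A M C
  coassoc : ∀ m, assoc A A M C C (map coact LinearMap.id (coact m)) =
    map LinearMap.id (Coring.comul (A := A) (C := C)).left (coact m)
  counit : ∀ m, rid A M (map LinearMap.id (Coring.counit (A := A) (C := C)).left (coact m)) = m

/-- Left comodules over an `A`-coring `C`. -/
class LeftComodule (A C N : Type*) [Ring A] [AddCommGroup C] [Module A C] [Module Aᵐᵒᵖ C]
    [SMulCommClass A Aᵐᵒᵖ C] [Coring A C] [AddCommGroup N] [Module A N] where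
  coact : N →ₗ[A] BTensor A C N
  coassoc : ∀ n, assoc A A C C N (map (Coring.comul (A := A) (C := C)).right LinearMap.id
    (coact n)) = map LinearMap.id coact (coact n)
  counit : ∀ n, lid A N (map (Coring.counit (A := A) (C := C)).right LinearMap.id (coact n)) = n

section comodules

variable (k A C : Type*) [CommRing k] [Ring A] [Algebra k A]
  [AddCommGroup C] [Module A C] [Module Aᵐᵒᵖ C] [SMulCommClass A Aᵐᵒᵖ C] [Coring A C]

/-- The coproduct makes `C` a right `C`-comodule. -/
instance regularRight : RightComodule A C C where
  coact := (Coring.comul (A := A) (C := C)).right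
  coassoc := Coring.coassoc
  counit := Coring.counit_right

/-- The coproduct makes `C` a left `C`-comodule. -/
instance regularLeft : LeftComodule A C C where
  coact := (Coring.comul (A := A) (C := C)).left
  coassoc := Coring.coassoc
  counit := Coring.counit_left

/-- A left `A`-module `C` is flat if `- ⊗_A C` preserves injectivity of maps of right `A`-modules.
It suffices to test modules in the universe of `A`, since inclusions of right ideals suffice. -/
def IsLeftFlat (A : Type u) (C : Type v) [Ring A] [AddCommGroup C] [Module A C] : Prop :=
  ∀ (X Y : Type u) [AddCommGroup X] [Module Aᵐᵒᵖ X] [AddCommGroup Y] [Module Aᵐᵒᵖ Y]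
    (f : X →ₗ[Aᵐᵒᵖ] Y), Function.Injective f →
    Function.Injective (map (A := A) f (LinearMap.id : C →ₗ[A] C))

/-- The group of right `C`-comodule maps `M → N`. -/
def rightHom (M N : Type*) [AddCommGroup M] [Module Aᵐᵒᵖ M] [RightComodule A C M]
    [AddCommGroup N] [Module Aᵐᵒᵖ N] [RightComodule A C N] : AddSubgroup (M →ₗ[Aᵐᵒᵖ] N) where
  carrier := {f | ∀ m, RightComodule.coact (C := C) (f m) =
    map f LinearMap.id (RightComodule.coact (C := C) m)}
  add_mem' := by
    intro f g hf hg m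
    simp [hf m, hg m, map_add_left]
  zero_mem' := by
    intro m
    simp [map_zero_left]
  neg_mem' := by
    intro f hf m
    simp [hf m, map_neg_left]

/-- The group of left `C`-comodule maps `M → N`. -/
def leftHom (M N : Type*) [AddCommGroup M] [Module A M] [LeftComodule A C M]
    [AddCommGroup N] [Module A N] [LeftComodule A C N] : AddSubgroup (M →ₗ[A] N) where
  carrier := {f | ∀ m, LeftComodule.coact (C := C) (f m) =
    map LinearMap.id f (LeftComodule.coact (C := C) m)}
  add_mem' := by
    intro f g hf hg m
    simp [hf m, hg m, map_add_right]
  zero_mem' := by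
    intro m
    simp [map_zero_right]
  neg_mem' := by
    intro f hf m
    simp [hf m, map_neg_right]

variable [Module k C] [IsScalarTower k A C] [IsScalarTower k Aᵐᵒᵖ C]
  (M N : Type*) [AddCommGroup M] [Module Aᵐᵒᵖ M] [Module k M] [IsScalarTower k Aᵐᵒᵖ M]
  [RightComodule A C M] [AddCommGroup N] [Module Aᵐᵒᵖ N] [RightComodule A C N]

variable {A C M} in
theorem coact_smul (r : k) (m : M) : RightComodule.coact (A := A) (C := C) (r • m) =
    map (r • LinearMap.id) LinearMap.id (RightComodule.coact (A := A) (C := C) m) := by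
  rw [← IsScalarTower.algebraMap_smul Aᵐᵒᵖ r m, map_smul]
  generalize RightComodule.coact (A := A) (C := C) m = t
  induction t using induction_on with
  | zero => simp
  | tmul x c =>
    rw [map_tmul, smul_tmul_right, IsScalarTower.algebraMap_smul,
      ← IsScalarTower.algebraMap_smul A r c, ← smul_tmul]
    congr 1
    exact IsScalarTower.algebraMap_smul Aᵐᵒᵖ r x
  | add s t hs ht => rw [smul_add, map_add, hs, ht]

/-- The endomorphism algebra of the right `C`-comodule `M`; the product is composition. -/
def comoduleEnd : Subalgebra k (Module.End Aᵐᵒᵖ M) where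
  carrier := {f | f ∈ rightHom A C M M}
  mul_mem' := by
    intro f g hf hg m
    change _ = map (f ∘ₗ g) (LinearMap.id ∘ₗ LinearMap.id) _
    rw [map_comp, ← hg, ← hf]
    rfl
  add_mem' hf hg := (rightHom A C M M).add_mem hf hg
  algebraMap_mem' r := coact_smul k r


/-- The right action `f · b = f ∘ b` of the endomorphism algebra on `C`-comodule maps `M → N`. -/
instance : Module (comoduleEnd k A C M)ᵐᵒᵖ (rightHom A C M N) where
  smul b f := ⟨f.1 ∘ₗ b.unop.1, by
    intro m
    change _ = map (f.1 ∘ₗ b.unop.1) (LinearMap.id ∘ₗ LinearMap.id) _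
    rw [map_comp, ← b.unop.2, ← f.2]
    rfl⟩
  one_smul f := rfl
  mul_smul b c f := rfl
  smul_zero b := rfl
  smul_add b f g := rfl
  add_smul b c f := Subtype.ext (LinearMap.ext fun m => map_add f.1 _ _)
  zero_smul f := Subtype.ext (LinearMap.ext fun m => map_zero f.1)

@[simp]
theorem op_smul_apply (b : (comoduleEnd k A C M)ᵐᵒᵖ) (f : rightHom A C M N) (m : M) :
    (b • f).1 m = f.1 (b.unop.1 m) := rfl

/-- `Hom^C(M, N) ⊗_B M`, where `B = End^C(M)`. -/
abbrev HomTensor : Type _ := BTensor (comoduleEnd k A C M) (rightHom A C M N) M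

variable {A C M N} in
/-- The right `A`-linear map `m ↦ f ⊗ m` from `M` to `Hom^C(M, N) ⊗_B M`. -/
def homTmul (f : rightHom A C M N) : M →ₗ[Aᵐᵒᵖ] HomTensor k A C M N :=
  tmulRight (A := comoduleEnd k A C M) (S := A) f

variable {A C M N} in
@[simp]
theorem homTmul_apply (f : rightHom A C M N) (m : M) :
    homTmul k f m = tmul (comoduleEnd k A C M) f m := rfl

variable {A C M N} in
theorem homTmul_op_smul (f : rightHom A C M N) (b : comoduleEnd k A C M) :
    homTmul k (op b • f) = homTmul k f ∘ₗ b.1 :=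
  LinearMap.ext fun m => smul_tmul f b m

variable {A C M N} in
theorem homTmul_add (f g : rightHom A C M N) : homTmul k (f + g) = homTmul k f + homTmul k g :=
  LinearMap.ext fun m => add_tmul f g m

/-- The coaction `f ⊗ m ↦ (f ⊗ m₀) ⊗ m₁` of `Hom^C(M, N) ⊗_B M`, where `B = End^C(M)`. -/
def homTensorCoact : HomTensor k A C M N →ₗ[Aᵐᵒᵖ] BTensor A (HomTensor k A C M N) C :=
  liftRight (AddMonoidHom.mk' (fun f => mapRight (homTmul k f) ∘ₗ RightComodule.coact) (by
    intro f g
    ext m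
    change map (homTmul k (f + g)) LinearMap.id _ = _
    rw [homTmul_add, map_add_left]
    rfl)) (by
    intro f b m
    change map (homTmul k (op b • f)) LinearMap.id _ =
      map (homTmul k f) LinearMap.id (RightComodule.coact (b.1 m))
    rw [homTmul_op_smul, b.2 m, ← map_comp]
    rfl)

variable {A C M N} in
theorem homTensorCoact_tmul (f : rightHom A C M N) (m : M) :
    homTensorCoact k A C M N (tmul _ f m) =
      map (homTmul k f) LinearMap.id (RightComodule.coact (A := A) (C := C) m) := rfl

/-- The right `C`-comodule `Hom^C(M, N) ⊗_B M`, where `B = End^C(M)`. -/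
instance homTensorComodule : RightComodule A C (HomTensor k A C M N) where
  coact := homTensorCoact k A C M N
  coassoc := by
    intro t
    induction t using induction_on with
    | zero => simp
    | tmul f m =>
      have h := congrArg (map (homTmul k f) LinearMap.id)
        (RightComodule.coassoc (A := A) (C := C) m)
      rw [← map_comp, LinearMap.comp_id, LinearMap.id_comp] at h
      rw [homTensorCoact_tmul, ← map_comp, ← map_comp, LinearMap.comp_id, LinearMap.id_comp,
        LinearMap.comp_id, ← h]
      generalize RightComodule.coact (A := A) (C := C) m = t
      induction t using induction_on with
      | zero => simp only [map_zero]
      | tmul m c =>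
        rw [map_tmul, map_tmul, LinearMap.comp_apply, homTmul_apply, homTensorCoact_tmul,
          LinearMap.id_apply]
        generalize RightComodule.coact (A := A) (C := C) m = t
        induction t using induction_on with
        | zero => simp only [map_zero, zero_tmul]
        | tmul m c => rw [map_tmul, assoc_tmul, assoc_tmul, map_tmul]; rfl
        | add s t hs ht => simp only [map_add, add_tmul, hs, ht]
      | add s t hs ht => simp only [map_add, hs, ht]
    | add s t hs ht => simp only [map_add, hs, ht]
  counit := by
    intro t
    induction t using induction_on with
    | zero => simp only [map_zero]
    | tmul f m =>
      have h := congrArg (homTmul k f) (RightComodule.counit (A := A) (C := C) m)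
      rw [homTensorCoact_tmul, ← map_comp, LinearMap.id_comp, LinearMap.comp_id]
      refine Eq.trans ?_ h
      generalize RightComodule.coact (A := A) (C := C) m = t
      induction t using induction_on with
      | zero => simp only [map_zero]
      | tmul m c => simp only [map_tmul, rid_tmul, map_smul, LinearMap.id_apply]
      | add s t hs ht => simp only [map_add, hs, ht]
    | add s t hs ht => simp only [map_add, hs, ht]

/-- The evaluation map `φ_N : Hom^C(M, N) ⊗_B M → N`, `f ⊗ m ↦ f(m)`, where `B = End^C(M)`. -/
def evalMap : rightHom A C (HomTensor k A C M N) N where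
  val := liftRight (rightHom A C M N).subtype fun _ _ _ => rfl
  property := by
    intro t
    induction t using induction_on with
    | zero => simp
    | tmul f m =>
      refine (f.2 m).trans ?_
      change _ = map _ _ (map (homTmul k f) LinearMap.id (RightComodule.coact m))
      rw [← map_comp]
      rfl
    | add s t hs ht => simp only [map_add, hs, ht]

/-- `M` is a Galois comodule: it is finitely generated projective as a right `A`-module, and the
evaluation map `φ_C : Hom^C(M, C) ⊗_B M → C`, `f ⊗ m ↦ f(m)`, is an isomorphism of right
`C`-comodules. -/
def IsGaloisComodule (k A C M : Type*) [CommRing k] [Ring A] [Algebra k A]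
    [AddCommGroup C] [Module A C] [Module Aᵐᵒᵖ C] [SMulCommClass A Aᵐᵒᵖ C] [Coring A C]
    [Module k C] [IsScalarTower k A C] [IsScalarTower k Aᵐᵒᵖ C] [AddCommGroup M] [Module Aᵐᵒᵖ M]
    [Module k M] [IsScalarTower k Aᵐᵒᵖ M] [RightComodule A C M] : Prop :=
  Module.Finite Aᵐᵒᵖ M ∧ Module.Projective Aᵐᵒᵖ M ∧
    ∃ g : rightHom A C C (HomTensor k A C M C),
      (evalMap k A C M C).1 ∘ₗ g.1 = LinearMap.id ∧ g.1 ∘ₗ (evalMap k A C M C).1 = LinearMap.id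

end comodules

section dual

variable (A M : Type*) [Ring A] [AddCommGroup M] [Module Aᵐᵒᵖ M]

/-- The dual `M* = Hom_A(M, A)` of a right `A`-module `M`, a left `A`-module by
`(a · ξ)(m) = a * ξ m`. -/
abbrev Dual := M →ₗ[Aᵐᵒᵖ] A

theorem exists_dualBasis [Module.Finite Aᵐᵒᵖ M] [Module.Projective Aᵐᵒᵖ M] :
    ∃ (n : ℕ) (e : Fin n → M) (ξ : Fin n → Dual A M), ∀ m, ∑ i, op (ξ i m) • e i = m := by
  obtain ⟨n, f, g, -, -, h⟩ := Module.Finite.exists_comp_eq_id_of_projective Aᵐᵒᵖ M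
  refine ⟨n, fun i => f (Pi.single i 1), fun i =>
    { toFun := fun m => unop (g m i)
      map_add' := by simp
      map_smul' := by simp }, fun m => ?_⟩
  have := LinearMap.congr_fun h m
  simp only [LinearMap.comp_apply, LinearMap.id_apply] at this
  conv_rhs => rw [← this, ← Finset.univ_sum_single (g m), map_sum]
  refine Finset.sum_congr rfl fun i _ => ?_
  rw [← map_smul, ← Pi.single_smul]
  simp

variable [Module.Finite Aᵐᵒᵖ M] [Module.Projective Aᵐᵒᵖ M]

/-- The size of a chosen dual basis of `M`. -/
noncomputable def dualCard : ℕ := (exists_dualBasis A M).choose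

/-- The vectors `e i` of a chosen dual basis of `M`. -/
noncomputable def dualVec : Fin (dualCard A M) → M := (exists_dualBasis A M).choose_spec.choose

/-- The functionals `ξ i` of a chosen dual basis of `M`. -/
noncomputable def dualCovec : Fin (dualCard A M) → Dual A M :=
  (exists_dualBasis A M).choose_spec.choose_spec.choose

variable {A M} in
theorem dualBasis_sum (m : M) : ∑ i : Fin (dualCard A M), op (dualCovec A M i m) • dualVec A M i = m :=
  (exists_dualBasis A M).choose_spec.choose_spec.choose_spec m

variable {A M} in
theorem dualBasis_sum_dual (ξ : Dual A M) :
    ∑ i : Fin (dualCard A M), ξ (dualVec A M i) • dualCovec A M i = ξ := by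
  ext m
  conv_rhs => rw [← dualBasis_sum (A := A) m]
  simp

end dual

section dualTensor

variable (k A M : Type*) [CommRing k] [Ring A] [Algebra k A]
  [AddCommGroup M] [Module Aᵐᵒᵖ M] [Module k M]

/-- The left `A`-module `M* ⊗ M` (tensor product over `k`). -/
def DualTensor : Type _ := Dual A M ⊗[k] M

instance : AddCommGroup (DualTensor k A M) := inferInstanceAs (AddCommGroup (Dual A M ⊗[k] M))

/-- The action `a · (ξ ⊗ m) = (a · ξ) ⊗ m`. -/
instance : Module A (DualTensor k A M) := inferInstanceAs (Module A (Dual A M ⊗[k] M))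

variable {A M} in
/-- The element `ξ ⊗ m` of `M* ⊗ M`. -/
def dtmul (ξ : Dual A M) (m : M) : DualTensor k A M := ξ ⊗ₜ m

variable {k A M} in
@[elab_as_elim]
theorem DualTensor.induction_on {p : DualTensor k A M → Prop} (t : DualTensor k A M) (zero : p 0)
    (tmul : ∀ ξ m, p (dtmul k ξ m)) (add : ∀ s t, p s → p t → p (s + t)) : p t :=
  TensorProduct.induction_on t zero tmul add

variable {A M} in
/-- For `m` in `M`, the left `A`-linear map `M* → M* ⊗ M`, `ξ ↦ ξ ⊗ m`. -/
def dualTmul (m : M) : Dual A M →ₗ[A] DualTensor k A M where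
  toFun ξ := dtmul k ξ m
  map_add' ξ η := TensorProduct.add_tmul ξ η m
  map_smul' _ _ := rfl

variable {A M} in
@[simp]
theorem dualTmul_apply (m : M) (ξ : Dual A M) : dualTmul k m ξ = dtmul k ξ m := rfl

variable {A M} in
theorem dualTmul_add (m m' : M) : dualTmul (A := A) k (m + m') = dualTmul k m + dualTmul k m' :=
  LinearMap.ext fun η => TensorProduct.tmul_add η m m'

variable {A M} in
theorem dtmul_smul (r : k) (ξ : Dual A M) (m : M) : dtmul k (r • ξ) m = dtmul k ξ (r • m) :=
  TensorProduct.smul_tmul r ξ m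

variable {k A M} in
/-- The left `A`-linear map out of `M* ⊗ M` induced by a `k`-balanced family of left `A`-linear
maps. -/
def DualTensor.lift {Z : Type*} [AddCommGroup Z] [Module A Z] (f : M →+ Dual A M →ₗ[A] Z)
    (h : ∀ (r : k) ξ m, f m (r • ξ) = f (r • m) ξ) : DualTensor k A M →ₗ[A] Z where
  toFun := TensorProduct.liftAddHom (AddMonoidHom.flip (AddMonoidHom.mk' (fun m =>
    (f m).toAddMonoidHom) fun m m' => by rw [map_add]; rfl)) h
  map_add' := map_add _
  map_smul' a t := by
    induction t using DualTensor.induction_on with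
    | zero => rw [smul_zero]; exact (map_zero (TensorProduct.liftAddHom _ _)).trans (smul_zero _).symm
    | tmul ξ m => exact map_smul (f m) a ξ
    | add s t hs ht =>
      rw [smul_add]
      refine (map_add (TensorProduct.liftAddHom _ _) _ _).trans ?_
      rw [hs, ht, ← smul_add]
      exact congrArg _ (map_add (TensorProduct.liftAddHom _ _) _ _).symm

variable {k A M} in
theorem DualTensor.lift_dtmul {Z : Type*} [AddCommGroup Z] [Module A Z]
    (f : M →+ Dual A M →ₗ[A] Z) (h : ∀ (r : k) ξ m, f m (r • ξ) = f (r • m) ξ) (ξ : Dual A M)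
    (m : M) : DualTensor.lift f h (dtmul k ξ m) = f m ξ := rfl

end dualTensor

section canonical

variable (k A C M : Type*) [CommRing k] [Ring A] [Algebra k A]
  [AddCommGroup C] [Module A C] [Module Aᵐᵒᵖ C] [SMulCommClass A Aᵐᵒᵖ C] [Coring A C]
  [Module k C] [IsScalarTower k A C] [IsScalarTower k Aᵐᵒᵖ C]
  [AddCommGroup M] [Module Aᵐᵒᵖ M] [Module k M] [IsScalarTower k Aᵐᵒᵖ M] [RightComodule A C M]

/-- The map sending `ξ` to the right `A`-linear map `m ↦ ξ(m₀) m₁`. -/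
def canAux : Dual A M →+ M →ₗ[Aᵐᵒᵖ] C where
  toFun ξ :=
    { toFun := fun m => lid A C (map ξ LinearMap.id (RightComodule.coact (A := A) (C := C) m))
      map_add' := by simp
      map_smul' := by
        intro a m
        rw [map_smul, map_smul_right _ _ _ (fun _ => rfl)]
        generalize map ξ LinearMap.id (RightComodule.coact (A := A) (C := C) m) = t
        induction t using induction_on with
        | zero => simp
        | tmul b c => simp [smul_comm]
        | add s t hs ht => simp only [map_add, smul_add, hs, ht] }
  map_zero' := by
    ext m
    simp [map_zero_left]
  map_add' ξ η := by
    ext m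
    simp [map_add_left]

variable {A C M} in
theorem canAux_apply (ξ : Dual A M) (m : M) : canAux A C M ξ m =
    lid A C (map ξ LinearMap.id (RightComodule.coact (A := A) (C := C) m)) := rfl

variable {A C M} in
theorem canAux_smul (a : A) (ξ : Dual A M) (m : M) :
    canAux A C M (a • ξ) m = a • canAux A C M ξ m := by
  rw [canAux_apply, canAux_apply]
  generalize RightComodule.coact (A := A) (C := C) m = t
  induction t using induction_on with
  | zero => simp
  | tmul m c => simp [mul_smul]
  | add s t hs ht => simp only [map_add, smul_add, hs, ht]

variable {A C M} in
theorem canAux_comp (ξ : Dual A M) (b : M →ₗ[Aᵐᵒᵖ] M) (hb : b ∈ rightHom A C M M) (m : M) :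
    canAux A C M (ξ ∘ₗ b) m = canAux A C M ξ (b m) := by
  rw [canAux_apply, canAux_apply, hb m, ← map_comp]
  rfl

variable {A C M} in
/-- The coproduct of `ξ(m₀) m₁`. -/
theorem comul_canAux [Module.Finite Aᵐᵒᵖ M] [Module.Projective Aᵐᵒᵖ M] (ξ : Dual A M) (m : M) :
    (Coring.comul (A := A) (C := C)).left (canAux A C M ξ m) =
      ∑ i : Fin (dualCard A M),
        tmul A (canAux A C M ξ (dualVec A M i)) (canAux A C M (dualCovec A M i) m) := by
  have h := congrArg (fun t => lid A _ (map ξ LinearMap.id t))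
    (RightComodule.coassoc (A := A) (C := C) m)
  simp only [← map_comp, LinearMap.id_comp, LinearMap.comp_id] at h
  have h1 : (Coring.comul (A := A) (C := C)).left (canAux A C M ξ m) =
      lid A _ (map ξ (Coring.comul (A := A) (C := C)).left (RightComodule.coact m)) := by
    rw [canAux_apply]
    generalize RightComodule.coact (A := A) (C := C) m = t
    induction t using induction_on with
    | zero => simp
    | tmul m c => simp
    | add s t hs ht => simp only [map_add, hs, ht]
  rw [h1, ← h]
  simp only [canAux_apply _ m]
  generalize RightComodule.coact (A := A) (C := C) m = t
  induction t using induction_on with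
  | zero => simp
  | tmul n c =>
    have h2 : ∑ i : Fin (dualCard A M), tmul A (canAux A C M ξ (dualVec A M i))
        (dualCovec A M i n • c) = tmul A (canAux A C M ξ n) c := by
      conv_rhs => rw [← dualBasis_sum (A := A) n, map_sum, sum_tmul]
      refine Finset.sum_congr rfl fun i _ => ?_
      rw [map_smul, smul_tmul]
    simp only [map_tmul, lid_tmul, LinearMap.id_apply]
    rw [h2, canAux_apply]
    generalize RightComodule.coact (A := A) (C := C) n = t
    induction t using induction_on with
    | zero => simp
    | tmul m c => simp
    | add s t hs ht => simp only [map_add, add_tmul, hs, ht]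
  | add s t hs ht => simp only [map_add, tmul_add, Finset.sum_add_distrib, hs, ht]

variable {A C M} in
/-- The counit of `ξ(m₀) m₁`. -/
theorem counit_canAux (ξ : Dual A M) (m : M) :
    (Coring.counit (A := A) (C := C)).left (canAux A C M ξ m) = ξ m := by
  conv_rhs => rw [← RightComodule.counit (A := A) (C := C) m]
  rw [canAux_apply]
  generalize RightComodule.coact (A := A) (C := C) m = t
  induction t using induction_on with
  | zero => simp
  | tmul m c => simp
  | add s t hs ht => simp only [map_add, hs, ht]

variable [Module.Finite Aᵐᵒᵖ M] [Module.Projective Aᵐᵒᵖ M]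

/-- The coaction `ξ ↦ ∑ i, ξ((e i)₀) (e i)₁ ⊗ ξ i` of `M*`, for a dual basis `(e i, ξ i)`
of `M`. -/
noncomputable def dualCoact : Dual A M →ₗ[A] BTensor A C (Dual A M) where
  toFun := fun ξ => ∑ i : Fin (dualCard A M),
    tmul A (canAux A C M ξ (dualVec A M i)) (dualCovec A M i)
  map_add' := by
    intro ξ η
    simp [add_tmul, Finset.sum_add_distrib]
  map_smul' := by
    intro a ξ
    simp [Finset.smul_sum, canAux_smul]

variable {A C M} in
theorem dualCoact_apply (ξ : Dual A M) : dualCoact A C M ξ = ∑ i : Fin (dualCard A M),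
    tmul A (canAux A C M ξ (dualVec A M i)) (dualCovec A M i) := rfl

/-- The left `C`-comodule `M*`. -/
noncomputable instance dualComodule : LeftComodule A C (Dual A M) where
  coact := dualCoact A C M
  coassoc := by
    intro ξ
    simp only [dualCoact_apply, map_sum, map_tmul, BimodHom.right_apply,
      comul_canAux, sum_tmul, tmul_sum, assoc_tmul, LinearMap.id_apply]
    exact Finset.sum_comm
  counit := by
    intro ξ
    simp only [dualCoact_apply, map_sum, map_tmul, BimodHom.right_apply,
      counit_canAux, lid_tmul, LinearMap.id_apply]
    exact dualBasis_sum_dual ξ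

variable {A C M} in
theorem dualCoact_smul (r : k) (ξ : Dual A M) : dualCoact A C M (r • ξ) =
    ∑ i : Fin (dualCard A M),
      tmul A (canAux A C M ξ (dualVec A M i)) (r • dualCovec A M i) := by
  rw [dualCoact_apply]
  refine Finset.sum_congr rfl fun i _ => ?_
  rw [← IsScalarTower.algebraMap_smul A r ξ, canAux_smul, IsScalarTower.algebraMap_smul,
    ← IsScalarTower.algebraMap_smul A r (dualCovec A M i), ← smul_tmul]
  congr 1
  exact (IsScalarTower.algebraMap_smul Aᵐᵒᵖ r _).symm

/-- The left `A`-linear map `ξ ↦ ρ(ξ) ⊗ m`. -/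
noncomputable def dualTensorCoactAt (m : M) : Dual A M →ₗ[A] BTensor A C (DualTensor k A M) :=
  mapLeft (R := A) (X := C) (dualTmul k m) ∘ₗ dualCoact A C M

variable {A C M} in
theorem dualTensorCoactAt_apply (ξ : Dual A M) (m : M) : dualTensorCoactAt k A C M m ξ =
    map LinearMap.id (dualTmul k m) (dualCoact A C M ξ) := rfl

/-- The family of left `A`-linear maps `ξ ↦ ρ(ξ) ⊗ m`. -/
noncomputable def dualTensorCoactAux : M →+ Dual A M →ₗ[A] BTensor A C (DualTensor k A M) :=
  AddMonoidHom.mk' (dualTensorCoactAt k A C M) (by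
    intro m m'
    refine LinearMap.ext fun ξ => ?_
    rw [LinearMap.add_apply, dualTensorCoactAt_apply, dualTensorCoactAt_apply,
      dualTensorCoactAt_apply, dualTmul_add, map_add_right, AddMonoidHom.add_apply])

variable {A C M} in
theorem dualTensorCoactAux_apply (ξ : Dual A M) (m : M) : dualTensorCoactAux k A C M m ξ =
    map LinearMap.id (dualTmul k m) (dualCoact A C M ξ) := rfl

/-- The left coaction of `M* ⊗ M`, given by the coaction of `M*`. -/
noncomputable def dualTensorCoact : DualTensor k A M →ₗ[A] BTensor A C (DualTensor k A M) :=
  DualTensor.lift (dualTensorCoactAux k A C M) (by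
    intro r ξ m
    rw [dualTensorCoactAux_apply, dualTensorCoactAux_apply, dualCoact_smul, dualCoact_apply,
      map_sum, map_sum]
    simp only [map_tmul, dualTmul_apply, dtmul_smul])

variable {A C M} in
theorem dualTensorCoact_tmul (ξ : Dual A M) (m : M) : dualTensorCoact k A C M (dtmul k ξ m) =
    map LinearMap.id (dualTmul k m) (dualCoact A C M ξ) := rfl

/-- The left `C`-comodule `M* ⊗ M`, with the coaction given by that of `M*`. -/
noncomputable instance dualTensorComodule : LeftComodule A C (DualTensor k A M) where
  coact := dualTensorCoact k A C M
  coassoc := by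
    intro t
    induction t using DualTensor.induction_on with
    | zero => simp only [map_zero]
    | tmul ξ m =>
      have h := congrArg (map LinearMap.id (mapLeft (R := A) (X := C) (dualTmul k m)))
        (LeftComodule.coassoc (A := A) (C := C) ξ)
      rw [← map_comp, LinearMap.id_comp] at h
      rw [dualTensorCoact_tmul, ← map_comp, ← map_comp, LinearMap.comp_id, LinearMap.id_comp]
      refine Eq.trans ?_ h
      change _ = map _ _ (assoc A A C C _ (map _ _ (dualCoact A C M ξ)))
      generalize dualCoact A C M ξ = t
      induction t using induction_on with
      | zero => simp only [map_zero]
      | tmul c η =>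
        rw [map_tmul, map_tmul, BimodHom.right_apply, LinearMap.id_apply]
        generalize (Coring.comul (A := A) (C := C)).left c = t
        induction t using induction_on with
        | zero => simp only [map_zero, zero_tmul]
        | tmul c d => rw [assoc_tmul, assoc_tmul, map_tmul]; rfl
        | add s t hs ht => simp only [map_add, add_tmul, hs, ht]
      | add s t hs ht => simp only [map_add, hs, ht]
    | add s t hs ht => simp only [map_add, hs, ht]
  counit := by
    intro t
    induction t using DualTensor.induction_on with
    | zero => simp only [map_zero]
    | tmul ξ m =>
      have h := congrArg (dualTmul k m) (LeftComodule.counit (A := A) (C := C) ξ)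
      rw [dualTensorCoact_tmul, ← map_comp, LinearMap.id_comp, LinearMap.comp_id]
      refine Eq.trans ?_ h
      generalize dualCoact A C M ξ = t
      induction t using induction_on with
      | zero => simp only [map_zero]
      | tmul c η => simp only [map_tmul, lid_tmul, map_smul, LinearMap.id_apply]
      | add s t hs ht => simp only [map_add, hs, ht]
    | add s t hs ht => simp only [map_add, hs, ht]

/-- For `m` in `M`, the left `C`-comodule map `M* → M* ⊗ M`, `ξ ↦ ξ ⊗ m`. -/
noncomputable def dualTmulHom (m : M) : leftHom A C (Dual A M) (DualTensor k A M) :=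
  ⟨dualTmul k m, fun _ => rfl⟩

/-- The family of left `A`-linear maps `ξ ↦ ξ(m₀) m₁`. -/
def canFamily : M →+ Dual A M →ₗ[A] C :=
  AddMonoidHom.mk' (fun m =>
    { toFun := fun ξ => canAux A C M ξ m
      map_add' := fun ξ η => by rw [map_add]; rfl
      map_smul' := fun a ξ => canAux_smul a ξ m }) (by
    intro m m'
    exact LinearMap.ext fun ξ => map_add (canAux A C M ξ) m m')

/-- The map `M* ⊗ M → C`, `ξ ⊗ m ↦ ξ(m₀) m₁`, of left `C`-comodules. -/
noncomputable def canTilde : leftHom A C (DualTensor k A M) C where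
  val := DualTensor.lift (canFamily A C M) (by
    intro r ξ m
    change canAux A C M (r • ξ) m = canAux A C M ξ (r • m)
    rw [← IsScalarTower.algebraMap_smul A r ξ, canAux_smul,
      ← IsScalarTower.algebraMap_smul Aᵐᵒᵖ r m, map_smul, IsScalarTower.algebraMap_smul,
      IsScalarTower.algebraMap_smul])
  property := by
    intro t
    induction t using DualTensor.induction_on with
    | zero => simp only [map_zero]
    | tmul ξ m =>
      refine (comul_canAux ξ m).trans ?_
      change _ = map LinearMap.id _ (dualTensorCoact k A C M (dtmul k ξ m))
      rw [dualTensorCoact_tmul, ← map_comp, dualCoact_apply, map_sum]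
      rfl
    | add s t hs ht => simp only [map_add, hs, ht]

variable {A C M} in
theorem canTilde_tmul (ξ : Dual A M) (m : M) : (canTilde k A C M).1 (dtmul k ξ m) =
    lid A C (map ξ LinearMap.id (RightComodule.coact (A := A) (C := C) m)) := rfl

/-- The endomorphism algebra `B` of `M` acts on the right of `M*` by left `C`-comodule maps
`ξ ↦ ξ ∘ b`. -/
noncomputable def dualPrecomp (b : comoduleEnd k A C M) : leftHom A C (Dual A M) (Dual A M) where
  val :=
    { toFun := fun ξ => ξ ∘ₗ b.1
      map_add' := fun _ _ => rfl
      map_smul' := fun _ _ => rfl }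
  property := by
    intro ξ
    change dualCoact A C M (ξ ∘ₗ b.1) = map _ _ (dualCoact A C M ξ)
    have h (i j : Fin (dualCard A M)) :
        tmul A (canAux A C M ξ (op (dualCovec A M j (b.1 (dualVec A M i))) • dualVec A M j))
          (dualCovec A M i) = tmul A (canAux A C M ξ (dualVec A M j))
            ((dualCovec A M j ∘ₗ b.1) (dualVec A M i) • dualCovec A M i) := by
      rw [map_smul, smul_tmul]
      rfl
    rw [dualCoact_apply, dualCoact_apply, map_sum]
    simp only [LinearMap.coe_mk, AddHom.coe_mk, canAux_comp ξ b.1 b.2, map_tmul, LinearMap.id_apply]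
    conv_lhs =>
      enter [2, i]
      rw [← dualBasis_sum (A := A) (b.1 (dualVec A M i)), map_sum, sum_tmul]
    simp only [h]
    rw [Finset.sum_comm]
    refine Finset.sum_congr rfl fun j _ => ?_
    rw [← tmul_sum, dualBasis_sum_dual]

/-- The left `B`-module structure `(b · f)(ξ) = f(ξ ∘ b)` on left `C`-comodule maps `M* → N`. -/
noncomputable instance leftHomModule (N : Type*) [AddCommGroup N] [Module A N]
    [LeftComodule A C N] : Module (comoduleEnd k A C M) (leftHom A C (Dual A M) N) where
  smul b f := ⟨f.1 ∘ₗ (dualPrecomp k A C M b).1, by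
    intro ξ
    rw [LinearMap.comp_apply, f.2, (dualPrecomp k A C M b).2, ← map_comp]
    rfl⟩
  one_smul f := rfl
  mul_smul b c f := rfl
  smul_zero b := rfl
  smul_add b f g := rfl
  add_smul b c f := Subtype.ext (LinearMap.ext fun ξ => by
    refine Eq.trans (congrArg f.1 ?_) (map_add f.1 _ _)
    exact LinearMap.comp_add b.1 c.1 ξ)
  zero_smul f := Subtype.ext (LinearMap.ext fun ξ => by
    refine Eq.trans (congrArg f.1 ?_) (map_zero f.1)
    exact LinearMap.comp_zero ξ)

variable {A C M} in
theorem leftHom_smul_apply {N : Type*} [AddCommGroup N] [Module A N] [LeftComodule A C N]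
    (b : comoduleEnd k A C M) (f : leftHom A C (Dual A M) N) (ξ : Dual A M) :
    (b • f).1 ξ = f.1 (ξ ∘ₗ b.1) := rfl

variable {A C M} in
theorem dualTmulHom_add (m m' : M) :
    dualTmulHom k A C M (m + m') = dualTmulHom k A C M m + dualTmulHom k A C M m' :=
  Subtype.ext (dualTmul_add k m m')

variable {A C M} in
theorem smul_dualTmulHom (r : k) (b : comoduleEnd k A C M) (m : M) :
    (r • b) • dualTmulHom k A C M m = b • dualTmulHom k A C M (r • m) := by
  refine Subtype.ext (LinearMap.ext fun ξ => ?_)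
  have h : ξ ∘ₗ (r • b).1 = r • (ξ ∘ₗ b.1) := LinearMap.ext fun m => by
    change ξ (r • b.1 m) = r • ξ (b.1 m)
    rw [← IsScalarTower.algebraMap_smul Aᵐᵒᵖ r (b.1 m), map_smul, IsScalarTower.algebraMap_smul]
  change dtmul k (ξ ∘ₗ (r • b).1) m = dtmul k (ξ ∘ₗ b.1) (r • m)
  rw [h, dtmul_smul]

/-- The biadditive map `(b, m) ↦ b · [ξ ↦ ξ ⊗ m] = [ξ ↦ (ξ ∘ b) ⊗ m]`. -/
noncomputable def homComparisonAux :
    comoduleEnd k A C M →+ M →+ leftHom A C (Dual A M) (DualTensor k A M) :=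
  AddMonoidHom.mk' (fun b => AddMonoidHom.mk' (fun m => b • dualTmulHom k A C M m)
    (fun m m' => by rw [dualTmulHom_add, smul_add]))
    (fun b b' => AddMonoidHom.ext fun m => add_smul b b' (dualTmulHom k A C M m))

/-- The left `B`-linear map `B ⊗ M → ^C Hom(M*, M* ⊗ M)`, `b ⊗ m ↦ [ξ ↦ (ξ ∘ b) ⊗ m]`. -/
noncomputable def homComparison :
    comoduleEnd k A C M ⊗[k] M →ₗ[comoduleEnd k A C M]
      leftHom A C (Dual A M) (DualTensor k A M) where
  toFun := TensorProduct.liftAddHom (homComparisonAux k A C M)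
    (fun r b m => smul_dualTmulHom k r b m)
  map_add' := map_add _
  map_smul' := by
    intro b t
    induction t using TensorProduct.induction_on with
    | zero => simp only [smul_zero, map_zero]
    | tmul c m => exact mul_smul b c (dualTmulHom k A C M m)
    | add s t hs ht => rw [smul_add, map_add, map_add, hs, ht, smul_add]

variable {A C M} in
theorem homComparison_tmul (b : comoduleEnd k A C M) (m : M) (ξ : Dual A M) :
    (homComparison k A C M (b ⊗ₜ m)).1 ξ = dtmul k (ξ ∘ₗ b.1) m := rfl

end canonical

/-- A left module `M` over a `k`-algebra `B` is `k`-relatively projective if every `B`-module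
epimorphism `N → M` that splits as a `k`-module map splits as a `B`-module map. -/
def IsRelativelyProjective (k B M : Type*) [CommRing k] [Ring B] [Algebra k B]
    [AddCommGroup M] [Module k M] [Module B M] [IsScalarTower k B M] : Prop :=
  ∀ (N : Type w) [AddCommGroup N] [Module k N] [Module B N] [IsScalarTower k B N]
    (p : N →ₗ[B] M), Function.Surjective p →
    (∃ s : M →ₗ[k] N, p.restrictScalars k ∘ₗ s = LinearMap.id) →
    ∃ t : M →ₗ[B] N, p ∘ₗ t = LinearMap.id

end GaloisCoring

/-!
# Galois comodules from a split canonical map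

Sending `ξ` to the map `m ↦ ξ(m₀) m₁` identifies `M*` with `Hom^C(M, C)`, so `φ_C` becomes the map
`M* ⊗_B M → C` induced by `canTilde`. Let `s` be a left colinear section of `canTilde`. For fixed
`m`, the map `ξ ↦ s (canTilde (ξ ⊗ m))` is left colinear from `M*` to `M* ⊗ M`, hence by the
bijectivity of the comparison map has the form `ξ ↦ ∑ (ξ ∘ bᵢ) ⊗ mᵢ` for a unique
`∑ bᵢ ⊗ mᵢ` in `B ⊗ M`. Applying `canTilde`, then the counit, and letting `ξ` run over the dual
of the finitely generated projective module `M`, one gets `∑ bᵢ(mᵢ) = m`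
(`actionMap_freeSection`).

Both conclusions follow from this identity. First, `m ↦ ∑ bᵢ ⊗ mᵢ` is a `B`-linear section of the
action `B ⊗ M → M`, so `M` is a direct summand of an induced module and is relatively projective
(`isRelativelyProjective_of_section`). Secondly, in `M* ⊗_B M` the element `s (canTilde (ξ ⊗ m))`
equals `∑ ξ ∘ bᵢ ⊗ mᵢ = ξ ⊗ ∑ bᵢ(mᵢ) = ξ ⊗ m`, so that `s`, followed by the projection to
`M* ⊗_B M`, is inverse to the map induced by `canTilde` (`toHomTensor_section`).
-/

namespace GaloisCoring

open BTensor

/-! ### Relative projectivity -/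

section relative

variable {k B M N : Type*} [CommRing k] [Ring B] [Algebra k B]
  [AddCommGroup M] [Module k M]
  [AddCommGroup N] [Module k N] [Module B N] [IsScalarTower k B N]

/-- The `B`-linear map `B ⊗ M → N`, `b ⊗ m ↦ b · f(m)`, induced by a `k`-linear map `f`. -/
noncomputable def inducedHom (f : M →ₗ[k] N) : B ⊗[k] M →ₗ[B] N where
  toFun := TensorProduct.lift ((Algebra.lsmul k k N).toLinearMap.compl₂ f)
  map_add' := map_add _
  map_smul' := by
    intro b t
    induction t using TensorProduct.induction_on with
    | zero => simp only [smul_zero, map_zero]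
    | tmul c m => exact mul_smul b c (f m)
    | add s t hs ht => rw [smul_add, map_add, map_add, hs, ht, smul_add]

@[simp]
theorem inducedHom_tmul (f : M →ₗ[k] N) (b : B) (m : M) :
    inducedHom f (b ⊗ₜ[k] m) = b • f m := rfl

/-- A direct summand of the induced module `B ⊗ M` is `k`-relatively projective: a `k`-linear
section of `N → M` extends to a `B`-linear map `B ⊗ M → N`. -/
theorem isRelativelyProjective_of_section [Module B M] [IsScalarTower k B M]
    (σ : M →ₗ[B] B ⊗[k] M) (hσ : ∀ m, inducedHom LinearMap.id (σ m) = m) :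
    IsRelativelyProjective.{w} k B M := by
  intro N _ _ _ _ p _ ⟨s, hs⟩
  refine ⟨inducedHom s ∘ₗ σ, LinearMap.ext fun m => ?_⟩
  refine Eq.trans ?_ (hσ m)
  rw [LinearMap.comp_apply, LinearMap.comp_apply]
  generalize σ m = t
  induction t using TensorProduct.induction_on with
  | zero => simp only [map_zero]
  | tmul b m =>
    rw [inducedHom_tmul, inducedHom_tmul, map_smul]
    exact congrArg (b • ·) (LinearMap.congr_fun hs m)
  | add t t' ht ht' => simp only [map_add, ht, ht']

end relative

/-! ### Inverses and composites of colinear maps -/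

/-- The inverse of a bijective colinear map is colinear. -/
theorem exists_rightHom_inverse {A C M N : Type*} [Ring A]
    [AddCommGroup C] [Module A C] [Module Aᵐᵒᵖ C] [SMulCommClass A Aᵐᵒᵖ C] [Coring A C]
    [AddCommGroup M] [Module Aᵐᵒᵖ M] [RightComodule A C M] [AddCommGroup N] [Module Aᵐᵒᵖ N]
    [RightComodule A C N] (f : rightHom A C M N) (hf : Function.Bijective f.1) :
    ∃ g : rightHom A C N M, f.1 ∘ₗ g.1 = LinearMap.id ∧ g.1 ∘ₗ f.1 = LinearMap.id := by
  let e := LinearEquiv.ofBijective f.1 hf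
  have hl : e.symm.toLinearMap ∘ₗ f.1 = LinearMap.id := LinearMap.ext e.symm_apply_apply
  refine ⟨⟨e.symm.toLinearMap, fun n => ?_⟩, LinearMap.ext e.apply_symm_apply, hl⟩
  obtain ⟨m, rfl⟩ := hf.2 n
  rw [f.2, ← map_comp, hl, LinearMap.id_comp, map_id]
  exact congrArg _ (LinearMap.congr_fun hl m)

theorem comp_mem_leftHom {A C L N P : Type*} [Ring A]
    [AddCommGroup C] [Module A C] [Module Aᵐᵒᵖ C] [SMulCommClass A Aᵐᵒᵖ C] [Coring A C]
    [AddCommGroup L] [Module A L] [LeftComodule A C L]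
    [AddCommGroup N] [Module A N] [LeftComodule A C N]
    [AddCommGroup P] [Module A P] [LeftComodule A C P]
    (f : leftHom A C N P) (g : leftHom A C L N) : f.1 ∘ₗ g.1 ∈ leftHom A C L P := by
  intro x
  rw [LinearMap.comp_apply, f.2, g.2, ← map_comp, LinearMap.id_comp]

variable {k A C M : Type*} [CommRing k] [Ring A] [Algebra k A]
  [AddCommGroup C] [Module A C] [Module Aᵐᵒᵖ C] [SMulCommClass A Aᵐᵒᵖ C] [Coring A C]
  [Module k C] [IsScalarTower k A C] [IsScalarTower k Aᵐᵒᵖ C]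
  [AddCommGroup M] [Module Aᵐᵒᵖ M] [Module k M] [IsScalarTower k Aᵐᵒᵖ M] [RightComodule A C M]

/-! ### The isomorphism between `M*` and `Hom^C(M, C)` -/

/-- A right colinear map `f : M → C` is recovered from `ε ∘ f`. -/
theorem canAux_counit_comp (f : rightHom A C M C) :
    canAux A C M ((Coring.counit (A := A) (C := C)).right ∘ₗ f.1) = f.1 := by
  refine LinearMap.ext fun m => ?_
  refine Eq.trans ?_ (Coring.counit_left (A := A) (f.1 m))
  have h : (Coring.comul (A := A) (C := C)).left (f.1 m) =
      map f.1 LinearMap.id (RightComodule.coact (A := A) (C := C) m) := f.2 m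
  rw [h, ← map_comp]
  rfl

variable [Module.Finite Aᵐᵒᵖ M] [Module.Projective Aᵐᵒᵖ M]

theorem canAux_mem_rightHom (ξ : Dual A M) : canAux A C M ξ ∈ rightHom A C M C := by
  intro m
  refine (comul_canAux ξ m).trans ?_
  simp only [canAux_apply _ m]
  generalize RightComodule.coact (A := A) (C := C) m = t
  induction t using induction_on with
  | zero => simp
  | tmul n c =>
    simp only [map_tmul, lid_tmul, LinearMap.id_apply]
    conv_rhs => rw [← dualBasis_sum (A := A) n, map_sum, sum_tmul]
    refine Finset.sum_congr rfl fun i _ => ?_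
    rw [map_smul, smul_tmul]
  | add s t hs ht => simp only [map_add, tmul_add, Finset.sum_add_distrib, hs, ht]

variable (A C M) in
/-- The map `M* → Hom^C(M, C)` sending `ξ` to `m ↦ ξ(m₀) m₁`. -/
def dualToHom : Dual A M →+ rightHom A C M C :=
  (canAux A C M).codRestrict _ canAux_mem_rightHom

theorem dualToHom_comp (ξ : Dual A M) (b : comoduleEnd k A C M) :
    dualToHom A C M (ξ ∘ₗ b.1) = op b • dualToHom A C M ξ :=
  Subtype.ext (LinearMap.ext fun m => canAux_comp ξ b.1 b.2 m)

/-- Colinear maps of the form `m ↦ ξ(m₀) m₁` separate the points of `M`. -/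
theorem eq_of_canAux_eq {m n : M} (h : ∀ ξ, canAux A C M ξ m = canAux A C M ξ n) : m = n := by
  have h' (ξ : Dual A M) : ξ m = ξ n := by
    rw [← counit_canAux (C := C) ξ m, h, counit_canAux]
  rw [← dualBasis_sum (A := A) m, ← dualBasis_sum (A := A) n]
  simp only [h']

/-! ### The projection `M* ⊗ M → Hom^C(M, C) ⊗_B M` -/

variable (k A C M) in
/-- The surjection `M* ⊗ M → Hom^C(M, C) ⊗_B M` obtained from `M* ≅ Hom^C(M, C)`. -/
def toHomTensor : DualTensor k A M →+ HomTensor k A C M C :=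
  TensorProduct.liftAddHom ((mk (comoduleEnd k A C M) (rightHom A C M C) M).comp
    (dualToHom A C M)) (by
    intro r ξ m
    have h : r • ξ = ξ ∘ₗ (algebraMap k (comoduleEnd k A C M) r).1 := LinearMap.ext fun m => by
      change r • ξ m = ξ (r • m)
      rw [← IsScalarTower.algebraMap_smul Aᵐᵒᵖ r m, map_smul, IsScalarTower.algebraMap_smul]
    change tmul _ (dualToHom A C M (r • ξ)) m = tmul _ (dualToHom A C M ξ) (r • m)
    rw [h, dualToHom_comp, smul_tmul, IsScalarTower.algebraMap_smul])

theorem toHomTensor_dtmul (ξ : Dual A M) (m : M) :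
    toHomTensor k A C M (dtmul k ξ m) = tmul _ (dualToHom A C M ξ) m := rfl

theorem evalMap_toHomTensor (t : DualTensor k A M) :
    (evalMap k A C M C).1 (toHomTensor k A C M t) = (canTilde k A C M).1 t := by
  induction t using DualTensor.induction_on with
  | zero => simp only [map_zero]
  | tmul ξ m => rfl
  | add s t hs ht => simp only [map_add, hs, ht]

theorem toHomTensor_surjective : Function.Surjective (toHomTensor k A C M) := by
  intro t
  induction t using induction_on with
  | zero => exact ⟨0, map_zero _⟩
  | tmul f m =>
    refine ⟨dtmul k ((Coring.counit (A := A) (C := C)).right ∘ₗ f.1) m, ?_⟩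
    rw [toHomTensor_dtmul]
    exact congrArg (tmul _ · m) (Subtype.ext (canAux_counit_comp f))
  | add s t hs ht =>
    obtain ⟨x, rfl⟩ := hs
    obtain ⟨y, rfl⟩ := ht
    exact ⟨x + y, map_add _ x y⟩

/-! ### The comparison map and the action `B ⊗ M → M` -/

variable (k A C M) in
/-- The action `B ⊗ M → M`, `b ⊗ m ↦ b(m)`. -/
noncomputable def actionMap : comoduleEnd k A C M ⊗[k] M →ₗ[comoduleEnd k A C M] M :=
  inducedHom LinearMap.id

theorem toHomTensor_homComparison (t : comoduleEnd k A C M ⊗[k] M) (ξ : Dual A M) :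
    toHomTensor k A C M ((homComparison k A C M t).1 ξ) =
      tmul _ (dualToHom A C M ξ) (actionMap k A C M t) := by
  induction t using TensorProduct.induction_on with
  | zero =>
    rw [map_zero, map_zero, tmul_zero]
    exact map_zero _
  | tmul b m =>
    rw [homComparison_tmul, toHomTensor_dtmul, dualToHom_comp, smul_tmul]
    rfl
  | add s t hs ht =>
    rw [map_add, map_add, tmul_add, ← hs, ← ht]
    exact map_add _ _ _

theorem canTilde_homComparison (t : comoduleEnd k A C M ⊗[k] M) (ξ : Dual A M) :
    (canTilde k A C M).1 ((homComparison k A C M t).1 ξ) =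
      canAux A C M ξ (actionMap k A C M t) := by
  rw [← evalMap_toHomTensor, toHomTensor_homComparison]
  rfl

/-- The `B`-linear map from `M` to left colinear maps `M* → M* ⊗ M` sending `m` to
`ξ ↦ s (ξ(m₀) m₁)`, for a left colinear map `s : C → M* ⊗ M`. -/
noncomputable def sectionHom (s : leftHom A C C (DualTensor k A M)) :
    M →ₗ[comoduleEnd k A C M] leftHom A C (Dual A M) (DualTensor k A M) where
  toFun m := ⟨(s.1 ∘ₗ (canTilde k A C M).1) ∘ₗ (dualTmulHom k A C M m).1,
    comp_mem_leftHom ⟨_, comp_mem_leftHom s (canTilde k A C M)⟩ (dualTmulHom k A C M m)⟩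
  map_add' m n := by
    rw [Subtype.ext_iff]
    change _ ∘ₗ (dualTmulHom k A C M (m + n)).1 = _
    rw [dualTmulHom_add]
    exact LinearMap.comp_add _ _ _
  map_smul' b m := Subtype.ext (LinearMap.ext fun ξ =>
    congrArg s.1 (canAux_comp ξ b.1 b.2 m).symm)

theorem sectionHom_apply (s : leftHom A C C (DualTensor k A M)) (m : M) (ξ : Dual A M) :
    (sectionHom s m).1 ξ = s.1 ((canTilde k A C M).1 (dtmul k ξ m)) := rfl

/-- The `B`-linear map `M → B ⊗ M` whose value at `m` represents `ξ ↦ s (ξ(m₀) m₁)` under the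
comparison isomorphism. -/
noncomputable def freeSection (hb : Function.Bijective (homComparison k A C M))
    (s : leftHom A C C (DualTensor k A M)) :
    M →ₗ[comoduleEnd k A C M] comoduleEnd k A C M ⊗[k] M :=
  (LinearEquiv.ofBijective _ hb).symm.toLinearMap ∘ₗ sectionHom s

theorem homComparison_freeSection (hb : Function.Bijective (homComparison k A C M))
    (s : leftHom A C C (DualTensor k A M)) (m : M) :
    homComparison k A C M (freeSection hb s m) = sectionHom s m :=
  (LinearEquiv.ofBijective _ hb).apply_symm_apply (sectionHom s m)

/-! ### Consequences of a colinear section -/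

/-- The action `B ⊗ M → M` is a split epimorphism of `B`-modules. -/
theorem actionMap_freeSection (hb : Function.Bijective (homComparison k A C M))
    {s : leftHom A C C (DualTensor k A M)}
    (hs : (canTilde k A C M).1 ∘ₗ s.1 = LinearMap.id) (m : M) :
    actionMap k A C M (freeSection hb s m) = m := by
  refine eq_of_canAux_eq (A := A) (C := C) fun ξ => ?_
  rw [← canTilde_homComparison, homComparison_freeSection, sectionHom_apply]
  exact LinearMap.congr_fun hs _

/-- Modulo the `B`-balancing relations, `s ∘ canTilde` is the identity. -/
theorem toHomTensor_section (hb : Function.Bijective (homComparison k A C M))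
    {s : leftHom A C C (DualTensor k A M)}
    (hs : (canTilde k A C M).1 ∘ₗ s.1 = LinearMap.id) (t : DualTensor k A M) :
    toHomTensor k A C M (s.1 ((canTilde k A C M).1 t)) = toHomTensor k A C M t := by
  induction t using DualTensor.induction_on with
  | zero => simp only [map_zero]
  | tmul ξ m =>
    rw [← sectionHom_apply, ← homComparison_freeSection hb, toHomTensor_homComparison,
      actionMap_freeSection hb hs, toHomTensor_dtmul]
  | add t u ht hu => simp only [map_add, ht, hu]

theorem evalMap_bijective (hb : Function.Bijective (homComparison k A C M))
    {s : leftHom A C C (DualTensor k A M)}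
    (hs : (canTilde k A C M).1 ∘ₗ s.1 = LinearMap.id) :
    Function.Bijective (evalMap k A C M C).1 := by
  refine ⟨fun t u h => ?_, fun c => ⟨toHomTensor k A C M (s.1 c), ?_⟩⟩
  · obtain ⟨x, rfl⟩ := toHomTensor_surjective t
    obtain ⟨y, rfl⟩ := toHomTensor_surjective u
    rw [evalMap_toHomTensor, evalMap_toHomTensor] at h
    rw [← toHomTensor_section hb hs, h, toHomTensor_section hb hs]
  · rw [evalMap_toHomTensor]
    exact LinearMap.congr_fun hs c

end GaloisCoring

open GaloisCoring in
theorem theorem2p1 (k A C M : Type*) [CommRing k] [Ring A] [Algebra k A]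
    [AddCommGroup C] [Module k C] [Module A C] [Module Aᵐᵒᵖ C] [SMulCommClass A Aᵐᵒᵖ C]
    [IsScalarTower k A C] [IsScalarTower k Aᵐᵒᵖ C] [Coring A C]
    [AddCommGroup M] [Module k M] [Module Aᵐᵒᵖ M] [IsScalarTower k Aᵐᵒᵖ M] [RightComodule A C M]
    [Module.Finite Aᵐᵒᵖ M] [Module.Projective Aᵐᵒᵖ M]
    (ha : IsLeftFlat A C)
    (hb : Function.Bijective (homComparison k A C M))
    (hc : ∃ s : leftHom A C C (DualTensor k A M), (canTilde k A C M).1 ∘ₗ s.1 = LinearMap.id) :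
    IsGaloisComodule k A C M ∧
      IsRelativelyProjective.{w} k (comoduleEnd k A C M) M := by
  obtain ⟨s, hs⟩ := hc
  exact ⟨⟨inferInstance, inferInstance,
    exists_rightHom_inverse (evalMap k A C M C) (evalMap_bijective hb hs)⟩,
    isRelativelyProjective_of_section (freeSection hb s) (actionMap_freeSection hb hs)⟩
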